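/- Let $S$ be a set with $|S|\le\mathfrak c$, where $\mathfrak c$ is the cardinality of the continuum, and let $\ell_1(S)$ be the real Banach space of absolutely summable functions on $S$ with the norm $\|x\|_1=\sum_{s\in S}|x(s)|$. Then for every dense linear subspace $Y$ of $\ell_1(S)$ there is a linear subspace $Z\subseteq Y$, dense in $\ell_1(S)$, which admits an analytic norm; that is, there is a norm $N$ on $Z$, equivalent to the restriction of $\|\cdot\|_1$ to $Z$, which is real analytic on $Z\setminus\{0\}$: for every $a\in Z\setminus\{0\}$ there are $\delta>0$ and continuous $n$-linear forms $p_n\colon Z^n\to\mathbb R$ ($n\ge 0$) such that the power series $\sum_{n} p_n(h,\dots,h)$ has positive radius of convergence (that is, $\sup_n\|p_n\|\,r^n<\infty$ for some $r>0$) and $$N(x)=\sum_{n=0}^\infty p_n(x-a,\dots,x-a)\qquad\text{for all } x\in Z \text{ with } \|x-a\|_1<\delta .$$ -/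

import Mathlib

/-- `N` is an equivalent norm on the real normed space `E`. (A seminorm that is bounded below by a
positive multiple of the norm of `E` is a norm.) -/
def IsEquivalentNorm {E : Type*} [NormedAddCommGroup E] [NormedSpace ℝ E]
    (N : Seminorm ℝ E) : Prop :=
  ∃ c C : ℝ, 0 < c ∧ 0 < C ∧ ∀ x : E, c * ‖x‖ ≤ N x ∧ N x ≤ C * ‖x‖

/-- The real normed space `E` admits an analytic norm: there is an equivalent norm on `E` which is
real analytic on `E \ {0}`, i.e. near each `a ≠ 0` it is the sum of a power series
`∑ₙ Pₙ(x - a)` of continuous homogeneous polynomials with positive radius of convergence.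
(Analyticity with respect to the given norm or to the equivalent norm is the same.) -/
def AdmitsAnalyticNorm (E : Type*) [NormedAddCommGroup E] [NormedSpace ℝ E] : Prop :=
  ∃ N : Seminorm ℝ E, IsEquivalentNorm N ∧ AnalyticOnNhd ℝ (fun x : E => N x) {0}ᶜ

open scoped Topology ENNReal ContDiff
open Filter

/-! A small perturbation of the identity carries the unit vectors of ℓ₁(S) into Y, so it suffices to
find a seminorm on ℓ₁(S) that is equivalent to the norm on finitely supported vectors and analytic
at the nonzero ones. Since |S| ≤ 𝔠, countably many sign functionals fₙ of norm at most 1 norm every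
finitely supported vector. With strictly decreasing weights wₙ → 1, put φₙ = wₙfₙ: if fₘ norms x ≠
0, then |φₘ(x)| strictly exceeds the bound wₘ₊₁‖x‖ on all later |φₙ(x)|. The seminorm is the gauge N
of {∑ φₙ^(2(n+1)) ≤ 1}. It dominates each |φₙ|, so at x/N(x) the later |φₙ| stay below some q < 1.
The growing exponents then make the sum converge to an analytic function F near x/N(x), and the
implicit function theorem applied to F(tx) = 1 makes N analytic (`analyticAt_gauge_evenPowerBall`).
-/

/-! ### The model power series on ℓ_∞ -/

/-- The power series `∑ₙ yₙ ^ (2 (n + 1))` at the origin of `ℓ_∞`. -/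
noncomputable def evenPowerSeries : FormalMultilinearSeries ℝ (lp (fun _ : ℕ => ℝ) ∞) ℝ := fun k =>
  if Even k ∧ k ≠ 0 then
    (ContinuousMultilinearMap.mkPiAlgebraFin ℝ k ℝ).compContinuousLinearMap
      (fun _ => lp.evalCLM ℝ (fun _ : ℕ => ℝ) ∞ (k / 2 - 1))
  else 0

theorem evenPowerSeries_apply_two_mul (n : ℕ) (y : lp (fun _ : ℕ => ℝ) ∞) :
    evenPowerSeries (2 * (n + 1)) (fun _ => y) = y n ^ (2 * (n + 1)) := by
  have h : Even (2 * (n + 1)) ∧ 2 * (n + 1) ≠ 0 := ⟨even_two_mul _, by omega⟩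
  have h2 : 2 * (n + 1) / 2 - 1 = n := by omega
  rw [evenPowerSeries, if_pos h]
  simp only [ContinuousMultilinearMap.compContinuousLinearMap_apply,
    ContinuousMultilinearMap.mkPiAlgebraFin_apply, List.ofFn_const, List.prod_replicate]
  rw [h2]
  rfl

theorem norm_evenPowerSeries_le (k : ℕ) : ‖evenPowerSeries k‖ ≤ 1 := by
  rw [evenPowerSeries]
  split_ifs with h
  · refine (ContinuousMultilinearMap.norm_compContinuousLinearMap_le _ _).trans ?_
    rw [ContinuousMultilinearMap.norm_mkPiAlgebraFin, one_mul]
    refine Finset.prod_le_one (fun _ _ => norm_nonneg _) fun _ _ => ?_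
    refine ContinuousLinearMap.opNorm_le_bound _ zero_le_one fun y => ?_
    rw [one_mul]
    exact lp.norm_apply_le_norm ENNReal.top_ne_zero y _
  · simp

theorem pow_two_mul_succ_le {q t : ℝ} (hq : q ≤ 1) (ht : |t| ≤ q) (n : ℕ) :
    t ^ (2 * (n + 1)) ≤ q ^ n := by
  have hq0 : 0 ≤ q := (abs_nonneg t).trans ht
  calc t ^ (2 * (n + 1)) = |t| ^ (2 * (n + 1)) := by rw [(even_two_mul _).pow_abs]
    _ ≤ q ^ (2 * (n + 1)) := by gcongr
    _ ≤ q ^ n := pow_le_pow_of_le_one hq0 hq (by omega)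

theorem hasFPowerSeriesOnBall_evenPowerSeries :
    HasFPowerSeriesOnBall (fun y : lp (fun _ : ℕ => ℝ) ∞ => ∑' n, y n ^ (2 * (n + 1)))
      evenPowerSeries 0 1 where
  r_le := by
    refine evenPowerSeries.le_radius_of_bound 1 (r := 1) fun n => ?_
    simpa using norm_evenPowerSeries_le n
  r_pos := one_pos
  hasSum := by
    intro y hy
    have hy1 : ‖y‖ < 1 := by simpa [← ENNReal.ofReal_one, Metric.eball_ofReal] using hy
    have hinj : Function.Injective (fun n : ℕ => 2 * (n + 1)) := fun a b h => by
      simp only at h; omega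
    rw [zero_add, ← hinj.hasSum_iff]
    · have : (fun k => evenPowerSeries k (fun _ => y)) ∘ (fun n : ℕ => 2 * (n + 1)) =
          fun n => y n ^ (2 * (n + 1)) := by
        ext n
        exact evenPowerSeries_apply_two_mul n y
      rw [this]
      refine Summable.hasSum (Summable.of_nonneg_of_le (fun n => (even_two_mul _).pow_nonneg _)
        (fun n => pow_two_mul_succ_le hy1.le ?_ n)
        (summable_geometric_of_lt_one (norm_nonneg y) hy1))
      exact lp.norm_apply_le_norm ENNReal.top_ne_zero y n
    · intro k hk
      have : ¬ (Even k ∧ k ≠ 0) := by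
        rintro ⟨⟨m, hm⟩, h0⟩
        exact hk ⟨m - 1, by simp only; omega⟩
      simp [evenPowerSeries, if_neg this]

/-! ### The even power sum and its sublevel body -/

section

variable {X : Type*} [NormedAddCommGroup X] [NormedSpace ℝ X]

/-- The sum `∑ₙ φₙ(x) ^ (2 (n + 1))`. -/
noncomputable def evenPowerSum (φ : ℕ → X →L[ℝ] ℝ) (x : X) : ℝ := ∑' n, φ n x ^ (2 * (n + 1))

/-- The points at which the functionals `φₙ` eventually stay in `[-q, q]` for some `q < 1`. -/
def eventuallySmall (φ : ℕ → X →L[ℝ] ℝ) : Set X :=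
  {x | ∃ q < (1 : ℝ), ∀ᶠ n in atTop, |φ n x| ≤ q}

theorem isOpen_eventuallySmall {φ : ℕ → X →L[ℝ] ℝ} {C : ℝ} (hφ : ∀ n x, |φ n x| ≤ C * ‖x‖) :
    IsOpen (eventuallySmall φ) := by
  rw [isOpen_iff_mem_nhds]
  rintro x ⟨q, hq, h⟩
  have hlim : Tendsto (fun y => q + C * ‖y - x‖) (𝓝 x) (𝓝 (q + C * ‖x - x‖)) :=
    Continuous.tendsto (by fun_prop) x
  rw [sub_self, norm_zero, mul_zero, add_zero] at hlim
  filter_upwards [hlim.eventually_lt_const hq] with y hy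
  refine ⟨_, hy, h.mono fun n hn => ?_⟩
  calc |φ n y| = |φ n x + φ n (y - x)| := by rw [map_sub]; ring_nf
    _ ≤ |φ n x| + |φ n (y - x)| := abs_add_le _ _
    _ ≤ _ := add_le_add hn (hφ n _)

theorem summable_of_mem_eventuallySmall {φ : ℕ → X →L[ℝ] ℝ} {x : X}
    (hx : x ∈ eventuallySmall φ) : Summable fun n => φ n x ^ (2 * (n + 1)) := by
  obtain ⟨q, hq, h⟩ := hx
  obtain ⟨n, hn⟩ := h.exists
  refine summable_of_isBigO_nat
    (summable_geometric_of_lt_one ((abs_nonneg _).trans hn) hq) (Asymptotics.IsBigO.of_bound 1 ?_)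
  filter_upwards [h] with n hn
  rw [Real.norm_of_nonneg ((even_two_mul _).pow_nonneg _), one_mul]
  exact (pow_two_mul_succ_le hq.le hn n).trans (le_abs_self _)

/-- The map x ↦ (φₙ x)ₙ is bounded and linear into ℓ_∞ and sends a into the open unit ball, where
the model series converges. -/
theorem analyticAt_evenPowerSum_of_forall {φ : ℕ → X →L[ℝ] ℝ} {C : ℝ}
    (hφ : ∀ n x, |φ n x| ≤ C * ‖x‖) {a : X} {q : ℝ} (hq : q < 1) (ha : ∀ n, |φ n a| ≤ q) :
    AnalyticAt ℝ (evenPowerSum φ) a := by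
  have hmem : ∀ x, Memℓp (fun n => φ n x) ∞ := fun x =>
    memℓp_infty ⟨C * ‖x‖, by rintro _ ⟨n, rfl⟩; exact hφ n x⟩
  let L : X →ₗ[ℝ] lp (fun _ : ℕ => ℝ) ∞ :=
    { toFun := fun x => ⟨fun n => φ n x, hmem x⟩
      map_add' := fun x y => lp.ext (funext fun n => map_add (φ n) x y)
      map_smul' := fun c x => lp.ext (funext fun n => map_smul (φ n) c x) }
  let G : X →L[ℝ] lp (fun _ : ℕ => ℝ) ∞ := L.mkContinuous |C| fun x =>
    lp.norm_le_of_forall_le (by positivity) fun n =>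
      (hφ n x).trans (mul_le_mul_of_nonneg_right (le_abs_self C) (norm_nonneg x))
  have hGa : G a ∈ Metric.eball (0 : lp (fun _ : ℕ => ℝ) ∞) 1 := by
    have : ‖G a‖ ≤ q := lp.norm_le_of_forall_le ((abs_nonneg _).trans (ha 0)) ha
    simpa [← ENNReal.ofReal_one, Metric.eball_ofReal] using this.trans_lt hq
  exact (hasFPowerSeriesOnBall_evenPowerSeries.analyticOnNhd _ hGa).comp (G.analyticAt a)

theorem analyticAt_evenPowerSum {φ : ℕ → X →L[ℝ] ℝ} {C : ℝ}
    (hφ : ∀ n x, |φ n x| ≤ C * ‖x‖) {a : X} (ha : a ∈ eventuallySmall φ) :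
    AnalyticAt ℝ (evenPowerSum φ) a := by
  obtain ⟨q, hq, h⟩ := id ha
  obtain ⟨m, hm⟩ := eventually_atTop.1 h
  -- Zeroing the first m functionals changes the sum only by a polynomial.
  let ψ : ℕ → X →L[ℝ] ℝ := fun n => if n < m then 0 else φ n
  have hq0 : 0 ≤ q := (abs_nonneg _).trans (hm m le_rfl)
  have hψ : ∀ n x, |ψ n x| ≤ |C| * ‖x‖ := by
    intro n x
    by_cases hn : n < m
    · simp only [ψ, if_pos hn, zero_apply, abs_zero]; positivity
    · simp only [ψ, if_neg hn]
      exact (hφ n x).trans (mul_le_mul_of_nonneg_right (le_abs_self C) (norm_nonneg x))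
  have hψa : ∀ n, |ψ n a| ≤ q := by
    intro n
    by_cases hn : n < m
    · simpa only [ψ, if_pos hn, zero_apply, abs_zero] using hq0
    · simpa only [ψ, if_neg hn] using hm n (not_lt.1 hn)
  have h1 : AnalyticAt ℝ (fun x => (∑ n ∈ Finset.range m, φ n x ^ (2 * (n + 1))) +
      evenPowerSum ψ x) a :=
    (Finset.analyticAt_fun_sum _ fun n _ => ((φ n).analyticAt a).pow _).add
      (analyticAt_evenPowerSum_of_forall hψ hq hψa)
  refine h1.congr ?_
  filter_upwards [(isOpen_eventuallySmall hφ).mem_nhds ha] with x hx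
  have hs := summable_of_mem_eventuallySmall hx
  rw [evenPowerSum, evenPowerSum, ← hs.sum_add_tsum_nat_add m,
    ← Summable.sum_add_tsum_nat_add (f := fun n => ψ n x ^ (2 * (n + 1))) m]
  · have h0 : ∑ n ∈ Finset.range m, ψ n x ^ (2 * (n + 1)) = 0 := by
      refine Finset.sum_eq_zero fun n hn => ?_
      simp [ψ, if_pos (Finset.mem_range.1 hn)]
    simp [h0, ψ]
  · refine hs.congr_cofinite ?_
    rw [Nat.cofinite_eq_atTop]
    filter_upwards [eventually_ge_atTop m] with n hn
    simp [ψ, if_neg (not_lt.2 hn)]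

/-- The convex set `∑ₙ φₙ(x) ^ (2 (n + 1)) ≤ 1`. -/
def evenPowerBall (φ : ℕ → X →L[ℝ] ℝ) : Set X :=
  {x | ∀ s : Finset ℕ, ∑ n ∈ s, φ n x ^ (2 * (n + 1)) ≤ 1}

theorem isClosed_evenPowerBall (φ : ℕ → X →L[ℝ] ℝ) : IsClosed (evenPowerBall φ) := by
  rw [evenPowerBall, Set.ofPred_forall]
  exact isClosed_iInter fun s => isClosed_le (by fun_prop) continuous_const

theorem convex_evenPowerBall (φ : ℕ → X →L[ℝ] ℝ) : Convex ℝ (evenPowerBall φ) := by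
  rw [evenPowerBall, Set.ofPred_forall]
  refine convex_iInter fun s => ?_
  have h : ConvexOn ℝ Set.univ (fun x => ∑ n ∈ s, φ n x ^ (2 * (n + 1))) := by
    refine ⟨convex_univ, fun x _ y _ a b ha hb hab => ?_⟩
    simp only [smul_eq_mul, Finset.mul_sum, ← Finset.sum_add_distrib]
    refine Finset.sum_le_sum fun n _ => ?_
    simpa using (even_two_mul (n + 1)).convexOn_pow.2 (Set.mem_univ (φ n x))
      (Set.mem_univ (φ n y)) ha hb hab
  simpa using h.convex_le 1

theorem balanced_evenPowerBall (φ : ℕ → X →L[ℝ] ℝ) : Balanced ℝ (evenPowerBall φ) := by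
  rw [balanced_iff_smul_mem]
  intro c hc x hx s
  refine (Finset.sum_le_sum fun n _ => ?_).trans (hx s)
  rw [map_smul, smul_eq_mul, mul_pow]
  refine mul_le_of_le_one_left ((even_two_mul _).pow_nonneg _) ?_
  rw [← (even_two_mul (n + 1)).pow_abs]
  exact pow_le_one₀ (abs_nonneg c) hc

theorem abs_apply_le_one_of_mem_evenPowerBall {φ : ℕ → X →L[ℝ] ℝ} {x : X}
    (hx : x ∈ evenPowerBall φ) (n : ℕ) : |φ n x| ≤ 1 := by
  have h := hx {n}
  rw [Finset.sum_singleton, ← (even_two_mul (n + 1)).pow_abs] at h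
  exact (pow_le_one_iff_of_nonneg (abs_nonneg _) (by omega)).1 h

theorem mem_evenPowerBall_of_forall {φ : ℕ → X →L[ℝ] ℝ} {x : X}
    (hx : ∀ n, |φ n x| ≤ 1 / 2) : x ∈ evenPowerBall φ := by
  intro s
  have h2 : ∀ n, φ n x ^ (2 * (n + 1)) ≤ 1 / 2 * (1 / 2 : ℝ) ^ n := fun n => by
    calc φ n x ^ (2 * (n + 1)) = |φ n x| ^ (2 * (n + 1)) := by rw [(even_two_mul _).pow_abs]
      _ ≤ (1 / 2 : ℝ) ^ (2 * (n + 1)) := by gcongr; exact hx n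
      _ ≤ (1 / 2 : ℝ) ^ (n + 1) := pow_le_pow_of_le_one (by norm_num) (by norm_num) (by omega)
      _ = _ := by rw [pow_succ']
  refine (Finset.sum_le_sum fun n _ => h2 n).trans ?_
  refine ((summable_geometric_two.mul_left (1 / 2 : ℝ)).sum_le_tsum s
    fun n _ => by positivity).trans ?_
  rw [tsum_mul_left, tsum_geometric_two]
  norm_num

/-- The body is defined by finite partial sums because `tsum` is 0 for a non-summable family; where
the series converges the two descriptions agree. -/
theorem mem_evenPowerBall_iff {φ : ℕ → X →L[ℝ] ℝ} {x : X} (hx : x ∈ eventuallySmall φ) :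
    x ∈ evenPowerBall φ ↔ evenPowerSum φ x ≤ 1 :=
  ⟨fun h => (summable_of_mem_eventuallySmall hx).tsum_le_of_sum_le h, fun h s =>
    ((summable_of_mem_eventuallySmall hx).sum_le_tsum s
      fun _ _ => (even_two_mul _).pow_nonneg _).trans h⟩

theorem ball_subset_evenPowerBall {φ : ℕ → X →L[ℝ] ℝ} {C : ℝ} (hC : 0 < C)
    (hφ : ∀ n x, |φ n x| ≤ C * ‖x‖) : Metric.ball 0 (1 / (2 * C)) ⊆ evenPowerBall φ := by
  intro x hx
  rw [mem_ball_zero_iff, lt_div_iff₀ (by positivity)] at hx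
  exact mem_evenPowerBall_of_forall fun n => (hφ n x).trans (by linarith)

theorem evenPowerBall_mem_nhds {φ : ℕ → X →L[ℝ] ℝ} {C : ℝ} (hC : 0 < C)
    (hφ : ∀ n x, |φ n x| ≤ C * ‖x‖) : evenPowerBall φ ∈ 𝓝 0 :=
  mem_of_superset (Metric.ball_mem_nhds 0 (by positivity)) (ball_subset_evenPowerBall hC hφ)

end

/-! ### Analyticity of the gauge -/

section

variable {X : Type*} [NormedAddCommGroup X] [NormedSpace ℝ X]

theorem evenPowerSum_eq_one_of_gauge_eq_one {φ : ℕ → X →L[ℝ] ℝ} {C : ℝ} (hC : 0 < C)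
    (hφ : ∀ n x, |φ n x| ≤ C * ‖x‖) {x : X} (hx : x ∈ eventuallySmall φ)
    (h : gauge (evenPowerBall φ) x = 1) : evenPowerSum φ x = 1 := by
  rw [gauge_eq_one_iff_mem_frontier (convex_evenPowerBall φ) (evenPowerBall_mem_nhds hC hφ),
    (isClosed_evenPowerBall φ).frontier_eq] at h
  refine le_antisymm ((mem_evenPowerBall_iff hx).1 h.1) (not_lt.1 fun hlt => h.2 ?_)
  rw [mem_interior_iff_mem_nhds]
  filter_upwards [(analyticAt_evenPowerSum hφ hx).continuousAt.eventually_lt_const hlt,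
    (isOpen_eventuallySmall hφ).mem_nhds hx] with y hy hy'
  exact (mem_evenPowerBall_iff hy').2 hy.le

/-- Every exponent is at least 2. This growth along rays keeps the radial derivative away from 0. -/
theorem sq_mul_evenPowerSum_le {φ : ℕ → X →L[ℝ] ℝ} {x : X} {c : ℝ} (hc : 1 ≤ c)
    (hx : x ∈ eventuallySmall φ) (hcx : c • x ∈ eventuallySmall φ) :
    c ^ 2 * evenPowerSum φ x ≤ evenPowerSum φ (c • x) := by
  rw [evenPowerSum, evenPowerSum, ← tsum_mul_left]
  refine ((summable_of_mem_eventuallySmall hx).mul_left _).tsum_le_tsum (fun n => ?_)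
    (summable_of_mem_eventuallySmall hcx)
  rw [map_smul, smul_eq_mul, mul_pow]
  exact mul_le_mul_of_nonneg_right (pow_le_pow_right₀ hc (by omega))
    ((even_two_mul _).pow_nonneg _)

theorem inv_le_deriv_evenPowerSum_smul {φ : ℕ → X →L[ℝ] ℝ} {C : ℝ}
    (hφ : ∀ n x, |φ n x| ≤ C * ‖x‖) {a : X} {μ d : ℝ} (hμ : 0 < μ)
    (ha : μ • a ∈ eventuallySmall φ) (h1 : evenPowerSum φ (μ • a) = 1)
    (hd : HasDerivAt (fun t : ℝ => evenPowerSum φ (t • a)) d μ) : μ⁻¹ ≤ d := by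
  have hlim := (hasDerivAt_iff_tendsto_slope.1 hd).mono_left
    (nhdsWithin_mono μ (fun t (ht : μ < t) => ht.ne') : 𝓝[>] μ ≤ 𝓝[≠] μ)
  have hev : ∀ᶠ t : ℝ in 𝓝[>] μ, t • a ∈ eventuallySmall φ :=
    nhdsWithin_le_nhds ((Continuous.tendsto (by fun_prop : Continuous fun t : ℝ => t • a) μ)
      ((isOpen_eventuallySmall hφ).mem_nhds ha))
  refine ge_of_tendsto hlim ?_
  filter_upwards [hev, self_mem_nhdsWithin] with t ht htμ
  have htμ : μ < t := htμ
  have hq : 1 ≤ t / μ := (one_le_div hμ).2 htμ.le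
  have hsm : (t / μ) • μ • a = t • a := by rw [smul_smul, div_mul_cancel₀ _ hμ.ne']
  have h := sq_mul_evenPowerSum_le hq ha (by rwa [hsm])
  rw [h1, mul_one, hsm] at h
  rw [slope_def_field, h1, le_div_iff₀ (sub_pos.2 htμ)]
  have : μ⁻¹ * (t - μ) = t / μ - 1 := by field_simp
  nlinarith

/-- The gauge of `∑ₙ φₙ(x) ^ (2 (n + 1)) ≤ 1` is analytic at every point whose normalization is
mapped by almost all `φₙ` into `[-q, q]` for some `q < 1`. -/
theorem analyticAt_gauge_evenPowerBall [CompleteSpace X] {φ : ℕ → X →L[ℝ] ℝ} {C : ℝ} (hC : 0 < C)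
    (hφ : ∀ n x, |φ n x| ≤ C * ‖x‖) {a : X} (h0 : 0 < gauge (evenPowerBall φ) a)
    (ha : (gauge (evenPowerBall φ) a)⁻¹ • a ∈ eventuallySmall φ) :
    AnalyticAt ℝ (gauge (evenPowerBall φ)) a := by
  set N := gauge (evenPowerBall φ) with hN
  have hNc : Continuous N :=
    continuous_gauge (convex_evenPowerBall φ) (evenPowerBall_mem_nhds hC hφ)
  have hone : ∀ x, 0 < N x → (N x)⁻¹ • x ∈ eventuallySmall φ →
      evenPowerSum φ ((N x)⁻¹ • x) = 1 := fun x hx hxs => by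
    refine evenPowerSum_eq_one_of_gauge_eq_one hC hφ hxs ?_
    rw [gauge_smul_of_nonneg (inv_nonneg.2 hx.le), smul_eq_mul, ← hN, inv_mul_cancel₀ hx.ne']
  let f : X × ℝ → ℝ := fun p => evenPowerSum φ (p.2 • p.1)
  let u : X × ℝ := (a, (N a)⁻¹)
  have hfu : f u = 1 := hone a h0 ha
  have hsmul : AnalyticAt ℝ (fun p : X × ℝ => p.2 • p.1) u := analyticAt_snd.smul analyticAt_fst
  have hf : AnalyticAt ℝ f u :=
    AnalyticAt.comp (g := evenPowerSum φ) (analyticAt_evenPowerSum hφ ha) hsmul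
  have cdf : ContDiffAt ℝ ω f u := hf.contDiffAt
  have hd : HasDerivAt (fun t : ℝ => evenPowerSum φ (t • a)) (fderiv ℝ f u (0, 1)) (N a)⁻¹ := by
    have hg : HasDerivAt (fun t : ℝ => (a, t)) ((0 : X), (1 : ℝ)) (N a)⁻¹ :=
      (hasDerivAt_const _ a).prodMk (hasDerivAt_id _)
    exact hf.differentiableAt.hasFDerivAt.comp_hasDerivAt (f := fun t : ℝ => (a, t)) _ hg
  have hpos : 0 < fderiv ℝ f u (0, 1) := (inv_pos.2 (inv_pos.2 h0)).trans_le
    (inv_le_deriv_evenPowerSum_smul hφ (inv_pos.2 h0) ha hfu hd)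
  -- The partial derivative in t is a nonzero scalar, so f(x, t) = 1 can be solved for t near (a, 1
  -- / N a).
  have if₂ : (fderiv ℝ f u ∘L .inr ℝ X ℝ).IsInvertible := by
    refine ⟨ContinuousLinearEquiv.unitsEquivAut ℝ (Units.mk0 _ hpos.ne'), ?_⟩
    ext
    simp
  have hω : (ω : WithTop ℕ∞) ≠ 0 := by simp
  have hψ : AnalyticAt ℝ (cdf.implicitFunction hω if₂) a :=
    (cdf.contDiffAt_implicitFunction hω if₂).analyticAt
  have hψa : cdf.implicitFunction hω if₂ a = (N a)⁻¹ := cdf.implicitFunction_apply_self hω if₂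
  have hcont : ContinuousAt (fun x => (N x)⁻¹) a := hNc.continuousAt.inv₀ h0.ne'
  have hpair : Tendsto (fun x => (x, (N x)⁻¹)) (𝓝 a) (𝓝 u) :=
    (continuousAt_id.prodMk hcont :)
  have hsm : ∀ᶠ x in 𝓝 a, (N x)⁻¹ • x ∈ eventuallySmall φ :=
    (hcont.smul continuousAt_id) ((isOpen_eventuallySmall hφ).mem_nhds ha)
  have hi : AnalyticAt ℝ (fun x => (cdf.implicitFunction hω if₂ x)⁻¹) a :=
    hψ.inv (by rw [hψa]; exact (inv_pos.2 h0).ne')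
  refine hi.congr ?_
  filter_upwards [hpair.eventually (cdf.eventually_apply_eq_iff_implicitFunction hω if₂), hsm,
    hNc.continuousAt.eventually_const_lt h0] with x hx hxs hx0
  rw [hx.1 (by rw [hfu]; exact hone x hx0 hxs), inv_inv]

/-- If `|φₘ|` exceeds at each point of `W` the upper limit of `|φₙ|` strictly, then some seminorm,
bounded by a multiple of the norm and dominating all `|φₙ|`, is analytic at all points of `W`. -/
theorem exists_seminorm_analyticAt [CompleteSpace X] {φ : ℕ → X →L[ℝ] ℝ} {C : ℝ} (hC : 0 < C)
    (hφ : ∀ n x, |φ n x| ≤ C * ‖x‖) :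
    ∃ N : Seminorm ℝ X, (∀ x, N x ≤ 2 * C * ‖x‖) ∧ (∀ n x, |φ n x| ≤ N x) ∧
      ∀ a, (∃ m, ∃ q < |φ m a|, ∀ᶠ n in atTop, |φ n a| ≤ q) → AnalyticAt ℝ N a := by
  have hnhds := evenPowerBall_mem_nhds hC hφ
  have hle : ∀ n x, |φ n x| ≤ gauge (evenPowerBall φ) x := by
    intro n x
    refine le_of_forall_pos_lt_add fun ε hε => ?_
    obtain ⟨b, hb0, hb, y, hy, rfl⟩ :=
      exists_lt_of_gauge_lt (absorbent_nhds_zero hnhds)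
        (lt_add_of_pos_right (gauge (evenPowerBall φ) x) hε)
    refine lt_of_le_of_lt ?_ hb
    simp only [map_smul, smul_eq_mul, abs_mul, abs_of_pos hb0]
    exact mul_le_of_le_one_right hb0.le (abs_apply_le_one_of_mem_evenPowerBall hy n)
  refine ⟨gaugeSeminorm (balanced_evenPowerBall φ) (convex_evenPowerBall φ)
    (absorbent_nhds_zero hnhds), fun x => ?_, hle, ?_⟩
  · have := mul_gauge_le_norm (x := x) (ball_subset_evenPowerBall hC hφ)
    rw [one_div, inv_mul_le_iff₀ (by positivity)] at this
    exact this
  · rintro a ⟨m, q, hq, h⟩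
    obtain ⟨n, hn⟩ := h.exists
    have h0 : 0 < gauge (evenPowerBall φ) a :=
      (((abs_nonneg _).trans hn).trans_lt hq).trans_le (hle m a)
    refine analyticAt_gauge_evenPowerBall hC hφ h0
      ⟨q / gauge (evenPowerBall φ) a, (div_lt_one h0).2 (hq.trans_le (hle m a)), h.mono fun n hn => ?_⟩
    rw [map_smul, smul_eq_mul, abs_mul, abs_of_pos (inv_pos.2 h0), inv_mul_eq_div]
    gcongr

end

/-! ### Norming functionals on ℓ₁(S) -/

theorem exists_clm_lp_one_eq_tsum_smul {S E : Type*} [NormedAddCommGroup E] [NormedSpace ℝ E]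
    [CompleteSpace E] (v : S → E) {K : ℝ} (hK : 0 ≤ K) (hv : ∀ s, ‖v s‖ ≤ K) :
    ∃ L : lp (fun _ : S => ℝ) 1 →L[ℝ] E, ‖L‖ ≤ K ∧ ∀ x, L x = ∑' s, x s • v s := by
  let T : S → ℝ →L[ℝ] E := fun s => ContinuousLinearMap.toSpanSingleton ℝ (v s)
  have hT : ∀ s, ‖T s‖ ≤ K := fun s => by simpa [T] using hv s
  refine ⟨(lp.tsumCLM ℝ S E).comp (lp.mapCLM 1 T hK hT), ?_, fun x => rfl⟩
  refine (ContinuousLinearMap.opNorm_comp_le _ _).trans ?_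
  calc _ ≤ 1 * K := mul_le_mul lp.norm_tsumCLM_le (lp.norm_mapCLM_le 1 T hK hT)
        (norm_nonneg _) zero_le_one
    _ = K := one_mul K

theorem norm_lp_one_eq_tsum_abs {S : Type*} (x : lp (fun _ : S => ℝ) 1) :
    ‖x‖ = ∑' s, |x s| := by
  rw [lp.norm_eq_tsum_rpow (by simp)]
  simp

/-- On a set of at most continuum cardinality, countably many `±1`-valued functions realize every
sign pattern on every finite subset. -/
theorem exists_seq_sign_of_mk_le_continuum {S : Type*} (hS : Cardinal.mk S ≤ Cardinal.continuum) :
    ∃ σ : ℕ → S → ℝ, (∀ n s, |σ n s| ≤ 1) ∧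
      ∀ x : S → ℝ, (Function.support x).Finite → ∃ n, ∀ s, x s * σ n s = |x s| := by
  classical
  obtain ⟨i⟩ : Nonempty (S ↪ ℝ) := by
    rw [← Cardinal.lift_mk_le', Cardinal.mk_real, Cardinal.lift_continuum]
    simpa using hS
  let B := TopologicalSpace.countableBasis ℝ
  have hB : TopologicalSpace.IsTopologicalBasis B := TopologicalSpace.isBasis_countableBasis ℝ
  have : Countable B := (TopologicalSpace.countable_countableBasis ℝ).to_subtype
  obtain ⟨e, he⟩ := exists_surjective_nat (Finset B)
  refine ⟨fun n s => if ∃ V ∈ e n, i s ∈ V.1 then 1 else -1, fun n s => ?_, fun x hx => ?_⟩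
  · dsimp only
    split_ifs <;> simp
  -- A basic open set around i s that misses the images of all other support points. The sets chosen
  -- at the points with x > 0 form the finite family coding the sign pattern.
  have hV : ∀ s, ∃ V : B, i s ∈ V.1 ∧ ∀ t, x t ≠ 0 → i t ∈ V.1 → t = s := by
    intro s
    have hfin : (i '' (Function.support x \ {s})).Finite := (hx.subset Set.sdiff_subset).image i
    have hmem : i s ∈ (i '' (Function.support x \ {s}))ᶜ := by
      rintro ⟨t, ht, hts⟩
      exact ht.2 (i.injective hts)
    obtain ⟨V, hVB, hsV, hVU⟩ := hB.exists_subset_of_mem_open hmem hfin.isClosed.isOpen_compl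
    refine ⟨⟨V, hVB⟩, hsV, fun t ht htV => ?_⟩
    by_contra hne
    exact hVU htV ⟨t, ⟨ht, hne⟩, rfl⟩
  choose V hsV hVt using hV
  have hpos : {s | 0 < x s}.Finite := hx.subset fun s (hs : 0 < x s) => hs.ne'
  obtain ⟨n, hn⟩ := he (hpos.toFinset.image V)
  refine ⟨n, fun s => ?_⟩
  dsimp only
  rw [hn]
  rcases lt_trichotomy (x s) 0 with h | h | h
  · rw [if_neg, abs_of_neg h, mul_neg_one]
    rintro ⟨W, hW, hsW⟩
    obtain ⟨t, ht, rfl⟩ := Finset.mem_image.1 hW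
    rw [hVt t s h.ne hsW] at h
    exact lt_asymm h (by simpa using ht)
  · simp [h]
  · rw [if_pos, abs_of_pos h, mul_one]
    exact ⟨V s, Finset.mem_image.2 ⟨s, by simpa using h, rfl⟩, hsV s⟩

/-- `ℓ₁(S)`, with `S` of at most continuum cardinality, has an equivalent seminorm which is analytic
at the nonzero finitely supported vectors and dominates the norm on them. -/
theorem exists_seminorm_lp_one_analyticAt {S : Type*} (hS : Cardinal.mk S ≤ Cardinal.continuum) :
    ∃ N : Seminorm ℝ (lp (fun _ : S => ℝ) 1), (∀ x, N x ≤ 4 * ‖x‖) ∧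
      ∀ x : lp (fun _ : S => ℝ) 1, (Function.support x).Finite →
        ‖x‖ ≤ N x ∧ (x ≠ 0 → AnalyticAt ℝ N x) := by
  obtain ⟨σ, hσ, hsign⟩ := exists_seq_sign_of_mk_le_continuum hS
  choose f hfn hf using fun n => exists_clm_lp_one_eq_tsum_smul (σ n) zero_le_one (hσ n)
  have hfle : ∀ n x, |f n x| ≤ ‖x‖ := fun n x => by
    simpa using (f n).le_of_opNorm_le (hfn n) x
  have hfeq : ∀ x : lp (fun _ : S => ℝ) 1, (Function.support x).Finite →
      ∃ n, f n x = ‖x‖ := fun x hx => by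
    obtain ⟨n, hn⟩ := hsign x hx
    exact ⟨n, by rw [hf, norm_lp_one_eq_tsum_abs]; exact tsum_congr hn⟩
  -- Strict decrease separates the norming index m from all later ones.
  let w : ℕ → ℝ := fun n => 1 + 1 / ((n : ℝ) + 1)
  have hw1 : ∀ n, 1 < w n := fun n => lt_add_of_pos_right 1 Nat.one_div_pos_of_nat
  have hw0 : ∀ n, 0 < w n := fun n => one_pos.trans (hw1 n)
  have hw2 : ∀ n, w n ≤ 2 := fun n => by
    have : 1 / ((n : ℝ) + 1) ≤ 1 := (div_le_one (by positivity)).2 (by simp)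
    simp only [w]; linarith
  let φ : ℕ → lp (fun _ : S => ℝ) 1 →L[ℝ] ℝ := fun n => w n • f n
  have hφ : ∀ n x, |φ n x| = w n * |f n x| := fun n x => by
    simp only [φ, smul_apply, smul_eq_mul, abs_mul, abs_of_pos (hw0 n)]
  obtain ⟨N, hN, hNφ, hNa⟩ := exists_seminorm_analyticAt (φ := φ) two_pos fun n x => by
    rw [hφ]
    exact mul_le_mul (hw2 n) (hfle n x) (abs_nonneg _) two_pos.le
  refine ⟨N, fun x => (hN x).trans_eq (by ring), fun x hx => ?_⟩
  obtain ⟨m, hm⟩ := hfeq x hx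
  have hφm : |φ m x| = w m * ‖x‖ := by rw [hφ, hm, abs_norm]
  refine ⟨?_, fun h0 => hNa x ⟨m, w (m + 1) * ‖x‖, ?_, ?_⟩⟩
  · refine le_trans ?_ (hNφ m x)
    rw [hφm]
    exact le_mul_of_one_le_left (norm_nonneg x) (hw1 m).le
  · rw [hφm]
    refine mul_lt_mul_of_pos_right ?_ (norm_pos_iff.2 h0)
    exact add_lt_add_right (Nat.one_div_lt_one_div m.lt_succ_self) 1
  · filter_upwards [eventually_ge_atTop (m + 1)] with n hn
    rw [hφ]
    refine mul_le_mul ?_ (hfle n x) (abs_nonneg _) (hw0 _).le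
    exact add_le_add_right (Nat.one_div_le_one_div hn) 1

/-! ### Moving the finitely supported vectors into Y -/

theorem finite_support_of_mem_span_single {S : Type*} [DecidableEq S]
    {x : lp (fun _ : S => ℝ) 1}
    (hx : x ∈ Submodule.span ℝ (Set.range fun s => lp.single (E := fun _ : S => ℝ) 1 s 1)) :
    (Function.support x).Finite := by
  induction hx using Submodule.span_induction with
  | mem x h =>
    obtain ⟨s, rfl⟩ := h
    refine (Set.finite_singleton s).subset fun t ht => ?_
    by_contra hne
    exact ht (lp.single_apply_ne 1 s 1 hne)
  | zero => exact Set.finite_empty.subset fun t ht => ht rfl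
  | add x y _ _ hx hy => exact (hx.union hy).subset (Function.support_add _ _)
  | smul c x _ hx => exact hx.subset (Function.support_const_smul_subset c _)

theorem dense_span_single {S : Type*} [DecidableEq S] :
    Dense (Submodule.span ℝ (Set.range fun s => lp.single (E := fun _ : S => ℝ) 1 s 1) :
      Set (lp (fun _ : S => ℝ) 1)) := by
  intro x
  refine mem_closure_of_tendsto (lp.hasSum_single ENNReal.one_ne_top x)
    (Eventually.of_forall fun F => Submodule.sum_mem _ fun s _ => ?_)
  have : lp.single (E := fun _ : S => ℝ) 1 s (x s) =
      x s • lp.single (E := fun _ : S => ℝ) 1 s 1 := by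
    rw [← lp.single_smul, smul_eq_mul, mul_one]
  rw [this]
  exact Submodule.smul_mem _ _ (Submodule.subset_span ⟨s, rfl⟩)

/-- The unit vectors of `ℓ₁(S)` can be moved into a dense set by an automorphism. -/
theorem exists_equiv_single_mem_of_dense {S : Type*} [DecidableEq S]
    {Y : Set (lp (fun _ : S => ℝ) 1)} (hY : Dense Y) :
    ∃ T : lp (fun _ : S => ℝ) 1 ≃L[ℝ] lp (fun _ : S => ℝ) 1, ∀ s, T (lp.single 1 s 1) ∈ Y := by
  choose y hy hyd using fun s => hY.exists_dist_lt
    (lp.single (E := fun _ : S => ℝ) 1 s 1) (one_half_pos (α := ℝ))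
  -- R sends each unit vector e to e - y with ‖R‖ ≤ 1/2, so 1 - R is invertible and sends e to y.
  obtain ⟨R, hR, hRx⟩ := exists_clm_lp_one_eq_tsum_smul
    (fun s => lp.single (E := fun _ : S => ℝ) 1 s 1 - y s) (one_half_pos (α := ℝ)).le
    (fun s => by rw [← dist_eq_norm]; exact (hyd s).le)
  refine ⟨ContinuousLinearEquiv.ofUnit
    (Units.oneSub R (hR.trans_lt one_half_lt_one)), fun s => ?_⟩
  have h1 : R (lp.single 1 s 1) = lp.single (E := fun _ : S => ℝ) 1 s 1 - y s := by
    rw [hRx, tsum_eq_single s]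
    · rw [lp.single_apply_self, one_smul]
    · intro t ht
      rw [lp.single_apply_ne 1 s _ ht, zero_smul]
  have h2 : ContinuousLinearEquiv.ofUnit (Units.oneSub R (hR.trans_lt one_half_lt_one))
      (lp.single 1 s 1) = lp.single 1 s 1 - R (lp.single 1 s 1) := rfl
  rw [h2, h1, sub_sub_cancel]
  exact hy s

/-- An equivalent norm on a subspace `D` that is analytic at the nonzero points of `D` transfers to
the image of `D` under an automorphism of the ambient space. -/
theorem admitsAnalyticNorm_map_equiv {X : Type*} [NormedAddCommGroup X] [NormedSpace ℝ X]
    (T : X ≃L[ℝ] X) (D : Submodule ℝ X) {N : Seminorm ℝ X} {C : ℝ} (hC : 0 < C)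
    (hN : ∀ x, N x ≤ C * ‖x‖) (hD : ∀ x ∈ D, ‖x‖ ≤ N x)
    (ha : ∀ x ∈ D, x ≠ 0 → AnalyticAt ℝ N x) :
    AdmitsAnalyticNorm (D.map (T : X →ₗ[ℝ] X)) := by
  let L : D.map (T : X →ₗ[ℝ] X) →L[ℝ] X :=
    (T.symm : X →L[ℝ] X).comp (D.map (T : X →ₗ[ℝ] X)).subtypeL
  have hTL : ∀ z, T (L z) = z := fun z => T.apply_symm_apply z
  have hL : ∀ z, L z ∈ D := by
    rintro ⟨_, x, hx, rfl⟩
    change T.symm (T x) ∈ D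
    rwa [T.symm_apply_apply]
  let A : X →L[ℝ] X := T
  -- Adding 1 keeps both constants positive even when X is trivial.
  refine ⟨N.comp (L : _ →ₗ[ℝ] X), ⟨(‖A‖ + 1)⁻¹, C * (‖L‖ + 1), by positivity, by positivity,
    fun z => ⟨?_, ?_⟩⟩, fun z hz => ?_⟩
  · rw [inv_mul_le_iff₀ (by positivity)]
    calc ‖z‖ = ‖A (L z)‖ := congrArg norm (hTL z).symm
      _ ≤ ‖A‖ * ‖L z‖ := A.le_opNorm _
      _ ≤ (‖A‖ + 1) * N (L z) :=
        mul_le_mul (by simp) (hD _ (hL z)) (norm_nonneg _) (by positivity)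
  · calc N (L z) ≤ C * ‖L z‖ := hN _
      _ ≤ C * (‖L‖ * ‖z‖) := by gcongr; exact L.le_opNorm z
      _ ≤ C * ((‖L‖ + 1) * ‖z‖) := by gcongr; simp
      _ = C * (‖L‖ + 1) * ‖z‖ := (mul_assoc _ _ _).symm
  · have h0 : L z ≠ 0 := fun h => by
      have hz0 : (z : X) = 0 := (hTL z).symm.trans (by rw [h, map_zero])
      exact hz (Submodule.coe_eq_zero.1 hz0)
    exact AnalyticAt.comp (g := N) (f := L) (ha _ (hL z) h0) (L.analyticAt z)

theorem mainTheorem5 {S : Type*} (hS : Cardinal.mk S ≤ Cardinal.continuum)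
    (Y : Submodule ℝ (lp (fun _ : S => ℝ) 1))
    (hY : Dense (Y : Set (lp (fun _ : S => ℝ) 1))) :
    ∃ Z : Submodule ℝ (lp (fun _ : S => ℝ) 1),
      Z ≤ Y ∧ Dense (Z : Set (lp (fun _ : S => ℝ) 1)) ∧ AdmitsAnalyticNorm Z := by
  classical
  obtain ⟨N, hN, hNfin⟩ := exists_seminorm_lp_one_analyticAt hS
  obtain ⟨T, hT⟩ := exists_equiv_single_mem_of_dense hY
  refine ⟨(Submodule.span ℝ (Set.range fun s => lp.single (E := fun _ : S => ℝ) 1 s 1)).map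
    (T : lp (fun _ : S => ℝ) 1 →ₗ[ℝ] lp (fun _ : S => ℝ) 1), ?_, ?_, ?_⟩
  · rw [Submodule.map_le_iff_le_comap, Submodule.span_le]
    rintro _ ⟨s, rfl⟩
    exact hT s
  · exact T.surjective.denseRange.dense_image T.continuous dense_span_single
  · exact admitsAnalyticNorm_map_equiv T _ four_pos hN
      (fun x hx => (hNfin x (finite_support_of_mem_span_single hx)).1)
      (fun x hx => (hNfin x (finite_support_of_mem_span_single hx)).2)
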